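/- Theorem (Cramér's theorem with exponential mean deviation frequency). Let $(X_i)_{i\ge 1}$ be an i.i.d. sequence of random vectors in $\mathbb{R}^d$ on a probability space $(\Omega,\mathcal A,\mathbb P)$ such that $$\Lambda(\lambda):=\ln \mathbb{E}\big[e^{\langle\lambda,X_1\rangle}\big]<\infty\qquad\text{for all }\lambda\in\mathbb{R}^d,$$ and let $\Lambda^*(x):=\sup_{\lambda\in\mathbb{R}^d}(\langle\lambda,x\rangle-\Lambda(\lambda))\in[0,\infty]$ be the Fenchel-Legendre transform of $\Lambda$. Then $X_1$ is integrable and $$\lim_{n\to\infty}\frac1n\sum_{i=1}^nX_i=\mathbb{E}[X_1]\qquad\text{almost surely,}$$ with exponential mean deviation frequency in the following sense. For $\varepsilon>0$ put $$\mathcal{O}_\varepsilon:=\sum_{n=1}^\infty\mathbf 1\Big\{\Big|\frac1n\sum_{i=1}^nX_i-\mathbb{E}[X_1]\Big|\ge\varepsilon\Big\},\qquad I_\varepsilon:=\inf_{|x-\mathbb{E}[X_1]|\ge\varepsilon}\Lambda^*(x)\in[0,\infty],$$ where $|\cdot|$ is the Euclidean norm, $\inf\emptyset=\infty$ and $e^{-\infty}=0$.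 Then for every $\varepsilon>0$ and every real $p$ with $0<p<I_\varepsilon$ there is a constant $C_{\varepsilon,p}>0$ such that $$\mathbb{E}\big[e^{p\mathcal{O}_\varepsilon}\big]\le K_{\varepsilon,p}:=C_{\varepsilon,p}\,\big(1-e^{-I_\varepsilon}\big)^{-1}\big(1-e^{-(I_\varepsilon-p)}\big)^{-1}<\infty,$$ and, with the same $K_{\varepsilon,p}$, $\mathbb{P}(\mathcal{O}_\varepsilon\ge k)\le K_{\varepsilon,p}\,e^{-pk}$ for all $k\in\{0,1,2,\dots\}$. -/

import Mathlib

open MeasureTheory ProbabilityTheory Filter Topology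
open scoped ENNReal

namespace MDF

variable {Ω : Type*} [MeasurableSpace Ω] {d : ℕ}

/-- The logarithmic moment generating function `Λ(l) = ln 𝔼[exp ⟪l, Y⟫]` of a random vector `Y`,
with values in `[-∞, ∞]`; it is `∞` exactly when the exponential moment is infinite. -/
noncomputable def logMGF (P : Measure Ω) (Y : Ω → EuclideanSpace ℝ (Fin d))
    (l : EuclideanSpace ℝ (Fin d)) : EReal :=
  ENNReal.log (∫⁻ ω, ENNReal.ofReal (Real.exp (inner ℝ l (Y ω))) ∂P)

/-- The Fenchel-Legendre transform `F*(x) = sup_l (⟪l, x⟫ - F(l))` of an extended real valued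
function `F` on `ℝ^d`. -/
noncomputable def fenchelLegendre (F : EuclideanSpace ℝ (Fin d) → EReal)
    (x : EuclideanSpace ℝ (Fin d)) : EReal :=
  ⨆ l : EuclideanSpace ℝ (Fin d), ((inner ℝ l x : ℝ) : EReal) - F l

/-- The mean `(1/n) ∑_{i=1}^n X_i` of the first `n` vectors of the sequence
`X_1 = X 0, X_2 = X 1, …`. -/
noncomputable def sampleMean (X : ℕ → Ω → EuclideanSpace ℝ (Fin d)) (n : ℕ) (ω : Ω) :
    EuclideanSpace ℝ (Fin d) :=
  (n : ℝ)⁻¹ • ∑ i ∈ Finset.range n, X i ω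

/-- The deviation frequency `O_ε = ∑_{n=1}^∞ 1{|Y_n - y| ≥ ε}`, with values in `[0, ∞]`. -/
noncomputable def deviationCount (Y : ℕ → Ω → EuclideanSpace ℝ (Fin d))
    (y : EuclideanSpace ℝ (Fin d)) (ε : ℝ) (ω : Ω) : ℝ≥0∞ :=
  ∑' n : ℕ, {ω' : Ω | ε ≤ ‖Y (n + 1) ω' - y‖}.indicator (fun _ => (1 : ℝ≥0∞)) ω

/-- The rate `inf {Λ*(x) : |x - y| ≥ ε}`, where `Λ*` is the Fenchel-Legendre transform of the
logarithmic moment generating function of `Y`; it is `∞` if there is no such `x`. -/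
noncomputable def deviationRate (P : Measure Ω) (Y : Ω → EuclideanSpace ℝ (Fin d))
    (y : EuclideanSpace ℝ (Fin d)) (ε : ℝ) : EReal :=
  ⨅ (x : EuclideanSpace ℝ (Fin d)) (_ : ε ≤ ‖x - y‖), fenchelLegendre (logMGF P Y) x

/-- The constant `K = C (1 - exp(-I))⁻¹ (1 - exp(-(I - p)))⁻¹`, where `exp(-∞) = 0`. -/
noncomputable def boundConst (C : ℝ) (I : EReal) (p : ℝ) : ℝ≥0∞ :=
  ENNReal.ofReal C * (1 - EReal.exp (-I))⁻¹ * (1 - EReal.exp (-(I - (p : EReal))))⁻¹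

end MDF

/-!
Since the constant `C` in the bound may depend on `ε` and `p`, and since both factors
`(1 - exp(-I))⁻¹` and `(1 - exp(-(I - p)))⁻¹` lie in `[1, ∞)` when `0 < p < I`, the heart of the
matter is that `𝔼[exp (p O)] < ∞` for every `0 < p < I`. The tail bound is then Markov's inequality
applied to `exp (p O)`.

Write `A_n` for the event that the mean of the first `n` vectors is at distance at least `ε` from
the expectation. If `A_n` is the last of these events to occur, then `O ≤ n`; hence
`exp (p O) ≤ 1 + ∑ n, exp (p n) 1_{A_n}` (`MDF.exp_mul_deviationCount_le`), and it suffices that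
`P(A_n)` decays like `exp (-q n)` for some `q` strictly between `p` and `I`.

This is the upper bound of Cramér's theorem for the closed set `A = {x | ε ≤ ‖x - 𝔼 X‖}`
(`MDF.exists_measure_le_exp`). As `q < I`, every point of `A` lies in one of the open half-spaces
`H_l = {x | ⟪l, x⟫ - Λ(l) > q}`, and finitely many of them cover `A`: the half-spaces belonging to
the vectors `± e_i` cover everything outside a bounded box, and the rest of `A` is compact
(`MDF.exists_finset_halfspace_cover`). By Chernoff's inequality the mean of the first `n` vectors
lies in a given `H_l` with probability at most `exp (-q n)` (`MDF.measure_sampleMean_le`).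
-/

namespace MDF

variable {Ω : Type*} [MeasurableSpace Ω] {P : Measure Ω} {d : ℕ}

/-! ### Exponential moments of a random vector -/

lemma integrable_exp_inner {Y : Ω → EuclideanSpace ℝ (Fin d)} (hY : Measurable Y)
    {l : EuclideanSpace ℝ (Fin d)} (h : logMGF P Y l < ⊤) :
    Integrable (fun ω => Real.exp (inner ℝ l (Y ω))) P := by
  rw [logMGF, ENNReal.log_lt_top_iff] at h
  refine (lintegral_ofReal_ne_top_iff_integrable ?_ ?_).1 h.ne
  · exact Measurable.aestronglyMeasurable (by fun_prop)
  · exact ae_of_all _ fun ω => (Real.exp_pos _).le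

lemma logMGF_eq_cgf [IsProbabilityMeasure P] {Y : Ω → EuclideanSpace ℝ (Fin d)}
    (hY : Measurable Y) {l : EuclideanSpace ℝ (Fin d)} (h : logMGF P Y l < ⊤) :
    logMGF P Y l = (cgf (fun ω => inner ℝ l (Y ω)) P 1 : ℝ) := by
  have hint := integrable_exp_inner hY h
  have hpos : 0 < mgf (fun ω => inner ℝ l (Y ω)) P 1 := mgf_pos (by simpa using hint)
  rw [logMGF, ← ofReal_integral_eq_lintegral_ofReal hint
    (ae_of_all _ fun ω => (Real.exp_pos _).le), cgf, ← ENNReal.log_ofReal_of_pos hpos]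
  simp [mgf]

/-- The vector is integrable because each coordinate has all its exponential moments. -/
lemma integrable_of_logMGF_lt_top [IsProbabilityMeasure P] {Y : Ω → EuclideanSpace ℝ (Fin d)}
    (hY : Measurable Y) (h : ∀ l, logMGF P Y l < ⊤) : Integrable Y P := by
  refine Integrable.of_eval_piLp fun i => ?_
  refine integrable_of_mem_interior_integrableExpSet (X := fun ω => Y ω i) ?_
  have huniv : integrableExpSet (fun ω => Y ω i) P = Set.univ := by
    refine Set.eq_univ_of_forall fun t => ?_
    have := integrable_exp_inner hY (h (EuclideanSpace.single i t))
    simpa [integrableExpSet, EuclideanSpace.inner_single_left] using this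
  simp [huniv]

/-! ### The upper bound of Cramér's theorem -/

/-- If open half-spaces `{x | q < ⟪l, x⟫ - L l}` cover a closed set and `L` is finite everywhere,
then finitely many of them do. The set need not be compact, since the half-spaces belonging to the
vectors `± e_i` already cover the complement of a bounded box. -/
lemma exists_finset_halfspace_cover (L : EuclideanSpace ℝ (Fin d) → ℝ)
    {A : Set (EuclideanSpace ℝ (Fin d))} (hA : IsClosed A) {q : ℝ}
    (h : ∀ x ∈ A, ∃ l, q < inner ℝ l x - L l) :
    ∃ S : Finset (EuclideanSpace ℝ (Fin d)), ∀ x ∈ A, ∃ l ∈ S, q < inner ℝ l x - L l := by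
  classical
  let e : Fin d → EuclideanSpace ℝ (Fin d) := fun i => EuclideanSpace.single i 1
  let S₀ : Finset (EuclideanSpace ℝ (Fin d)) :=
    Finset.univ.image e ∪ Finset.univ.image fun i => -e i
  let K : Set (EuclideanSpace ℝ (Fin d)) := A ∩ {x | ∀ l ∈ S₀, inner ℝ l x - L l ≤ q}
  have hKclosed : IsClosed K := by
    refine hA.inter ?_
    simp only [Set.ofPred_forall]
    exact isClosed_iInter fun l => isClosed_iInter fun _ =>
      isClosed_le (by fun_prop) continuous_const
  have hbox : IsCompact ((EuclideanSpace.equiv (Fin d) ℝ).symm ''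
      Set.pi Set.univ fun i => Set.Icc (-(q + L (-e i))) (q + L (e i))) :=
    (isCompact_univ_pi fun i => isCompact_Icc).image (EuclideanSpace.equiv (Fin d) ℝ).symm.continuous
  have hK : IsCompact K := by
    refine hbox.of_isClosed_subset hKclosed fun x hx => ?_
    refine ⟨EuclideanSpace.equiv (Fin d) ℝ x, fun i _ => ?_, by simp⟩
    have h₁ := hx.2 (e i) (by simp [S₀])
    have h₂ := hx.2 (-e i) (by simp [S₀])
    simp only [e, EuclideanSpace.inner_single_left, inner_neg_left, map_one, one_mul] at h₁ h₂
    constructor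
    · change -(q + L (-e i)) ≤ x i
      simp only [e]
      linarith
    · change x i ≤ q + L (e i)
      simp only [e]
      linarith
  obtain ⟨T, hT⟩ := hK.elim_finite_subcover (fun l => {x | q < inner ℝ l x - L l})
    (fun l => isOpen_lt continuous_const (by fun_prop)) fun x hx => by simpa using h x hx.1
  refine ⟨S₀ ∪ T, fun x hx => ?_⟩
  by_cases hx' : ∀ l ∈ S₀, inner ℝ l x - L l ≤ q
  · obtain ⟨l, hl, hlx⟩ := Set.mem_iUnion₂.1 (hT ⟨hx, hx'⟩)
    exact ⟨l, Finset.mem_union_right _ hl, hlx⟩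
  · push Not at hx'
    obtain ⟨l, hl, hlx⟩ := hx'
    exact ⟨l, Finset.mem_union_left _ hl, hlx⟩

lemma measurable_sampleMean {X : ℕ → Ω → EuclideanSpace ℝ (Fin d)} (hmeas : ∀ i, Measurable (X i))
    (n : ℕ) : Measurable (sampleMean X n) := by
  unfold sampleMean
  fun_prop

/-- **Chernoff's inequality** for the half-space `{x | q < ⟪l, x⟫ - Λ(l)}`. -/
lemma measure_sampleMean_le [IsProbabilityMeasure P] {X : ℕ → Ω → EuclideanSpace ℝ (Fin d)}
    (hmeas : ∀ i, Measurable (X i)) (hindep : iIndepFun X P)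
    (hident : ∀ i, IdentDistrib (X i) (X 0) P P) {l : EuclideanSpace ℝ (Fin d)}
    (hfin : logMGF P (X 0) l < ⊤) (q : ℝ) {n : ℕ} (hn : 0 < n) :
    P {ω | q < inner ℝ l (sampleMean X n ω) - cgf (fun ω => inner ℝ l (X 0 ω)) P 1}
      ≤ ENNReal.ofReal (Real.exp (-(q * n))) := by
  set c := cgf (fun ω => inner ℝ l (X 0 ω)) P 1 with hc
  let Z : ℕ → Ω → ℝ := fun i ω => inner ℝ l (X i ω)
  have hl : Measurable fun x : EuclideanSpace ℝ (Fin d) => inner ℝ l x := by fun_prop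
  have hZmeas : ∀ i, Measurable (Z i) := fun i => hl.comp (hmeas i)
  have hZindep : iIndepFun Z P := hindep.comp (fun _ x => inner ℝ l x) fun _ => hl
  have hZident : ∀ i, IdentDistrib (Z i) (Z 0) P P := fun i => (hident i).comp hl
  have hZ0 : Integrable (fun ω => Real.exp (1 * Z 0 ω)) P := by
    simpa [Z] using integrable_exp_inner (hmeas 0) hfin
  have hZint : ∀ i, Integrable (fun ω => Real.exp (1 * Z i ω)) P := fun i =>
    ((hZident i).comp (u := fun x => Real.exp (1 * x)) (by fun_prop)).integrable_iff.2 hZ0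
  have hn' : (0 : ℝ) < n := by exact_mod_cast hn
  have hcgf : cgf (∑ i ∈ Finset.range n, Z i) P 1 = n * c := by
    rw [hZindep.cgf_sum hZmeas fun i _ => hZint i]
    have : ∀ i ∈ Finset.range n, cgf (Z i) P 1 = c := fun i _ => by
      rw [hc, cgf, cgf, mgf_congr_of_identDistrib _ _ (hZident i)]
    rw [Finset.sum_congr rfl this]
    simp
  have hcher := measure_ge_le_exp_cgf (μ := P) (X := ∑ i ∈ Finset.range n, Z i) (t := 1)
    (n * (q + c)) zero_le_one (hZindep.integrable_exp_mul_sum hZmeas fun i _ => hZint i)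
  rw [hcgf] at hcher
  calc _ ≤ P {ω | n * (q + c) ≤ (∑ i ∈ Finset.range n, Z i) ω} := by
        refine measure_mono fun ω hω => ?_
        have hω : q < inner ℝ l (sampleMean X n ω) - c := hω
        rw [sampleMean, inner_smul_right, inner_sum] at hω
        have h₁ : q + c < (n : ℝ)⁻¹ * ∑ i ∈ Finset.range n, Z i ω := by
          simp only [Z]; linarith
        rw [inv_mul_eq_div, lt_div_iff₀ hn'] at h₁
        rw [Set.mem_ofPred_eq, Finset.sum_apply]
        linarith
    _ = ENNReal.ofReal (P.real {ω | n * (q + c) ≤ (∑ i ∈ Finset.range n, Z i) ω}) := by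
        rw [ofReal_measureReal]
    _ ≤ _ := by
        refine ENNReal.ofReal_le_ofReal (hcher.trans_eq ?_)
        congr 1
        ring

/-- The upper bound of Cramér's theorem for the complement of a ball, with an explicit geometric
rate `q` below the infimum of the rate function. -/
lemma exists_measure_le_exp [IsProbabilityMeasure P] {X : ℕ → Ω → EuclideanSpace ℝ (Fin d)}
    (hmeas : ∀ i, Measurable (X i)) (hindep : iIndepFun X P)
    (hident : ∀ i, IdentDistrib (X i) (X 0) P P) (hfin : ∀ l, logMGF P (X 0) l < ⊤)
    (y : EuclideanSpace ℝ (Fin d)) {ε q : ℝ} (hq : (q : EReal) < deviationRate P (X 0) y ε) :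
    ∃ N : ℕ, ∀ n : ℕ, 0 < n →
      P {ω | ε ≤ ‖sampleMean X n ω - y‖} ≤ N * ENNReal.ofReal (Real.exp (-(q * n))) := by
  let L : EuclideanSpace ℝ (Fin d) → ℝ := fun l => cgf (fun ω => inner ℝ l (X 0 ω)) P 1
  have hclosed : IsClosed {x : EuclideanSpace ℝ (Fin d) | ε ≤ ‖x - y‖} :=
    isClosed_le continuous_const (by fun_prop)
  obtain ⟨S, hS⟩ := exists_finset_halfspace_cover L hclosed (q := q) fun x hx => by
    have h₁ : (q : EReal) < fenchelLegendre (logMGF P (X 0)) x := hq.trans_le (iInf₂_le x hx)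
    obtain ⟨l, hl⟩ := lt_iSup_iff.1 h₁
    rw [logMGF_eq_cgf (hmeas 0) (hfin l)] at hl
    exact ⟨l, by exact_mod_cast hl⟩
  refine ⟨S.card, fun n hn => ?_⟩
  calc P {ω | ε ≤ ‖sampleMean X n ω - y‖}
      ≤ P (⋃ l ∈ S, {ω | q < inner ℝ l (sampleMean X n ω) - L l}) := by
        refine measure_mono fun ω hω => ?_
        simpa using hS _ hω
    _ ≤ ∑ l ∈ S, P {ω | q < inner ℝ l (sampleMean X n ω) - L l} := measure_biUnion_finset_le _ _
    _ ≤ ∑ _l ∈ S, ENNReal.ofReal (Real.exp (-(q * n))) :=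
        Finset.sum_le_sum fun l _ => measure_sampleMean_le hmeas hindep hident (hfin l) q hn
    _ = _ := by simp

/-! ### Exponential moments of the deviation frequency -/

/-- Up to and including a deviation at time `n`, at most `n` deviations have been counted, so
`exp (p O)` is at most one plus the sum of `exp (p n)` over all deviation times `n`; if there are
infinitely many of these, both sides are infinite. -/
lemma exp_mul_deviationCount_le {Ω : Type*} (Y : ℕ → Ω → EuclideanSpace ℝ (Fin d))
    (y : EuclideanSpace ℝ (Fin d)) (ε : ℝ) {p : ℝ} (hp : 0 ≤ p) (ω : Ω) :
    EReal.exp ((p : EReal) * (deviationCount Y y ε ω : EReal)) ≤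
      1 + ∑' n : ℕ, {ω' : Ω | ε ≤ ‖Y (n + 1) ω' - y‖}.indicator
        (fun _ => ENNReal.ofReal (Real.exp (p * (n + 1 : ℕ)))) ω := by
  set A : ℕ → Set Ω := fun n => {ω' : Ω | ε ≤ ‖Y (n + 1) ω' - y‖}
  -- The count of the first `m` indicators as a real number.
  let s : ℕ → ℝ := fun m => ∑ n ∈ Finset.range m, (A n).indicator (fun _ => (1 : ℝ)) ω
  have hs_le : ∀ m, s m ≤ m := fun m => by
    calc s m ≤ ∑ _n ∈ Finset.range m, (1 : ℝ) :=
          Finset.sum_le_sum fun n _ => Set.indicator_le_self' (fun _ _ => zero_le_one) ω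
      _ = m := by simp
  have hs_coe : ∀ m, ((∑ n ∈ Finset.range m, (A n).indicator (fun _ => (1 : ℝ≥0∞)) ω : ℝ≥0∞) : EReal)
      = (s m : ℝ) := fun m => by
    have : (∑ n ∈ Finset.range m, (A n).indicator (fun _ => (1 : ℝ≥0∞)) ω)
        = ENNReal.ofReal (s m) := by
      rw [ENNReal.ofReal_sum_of_nonneg fun n _ => Set.indicator_nonneg (fun _ _ => zero_le_one) ω]
      refine Finset.sum_congr rfl fun n _ => ?_
      by_cases h : ω ∈ A n <;> simp [h]
    rw [this, EReal.coe_ennreal_ofReal, max_eq_left]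
    exact Finset.sum_nonneg fun n _ => Set.indicator_nonneg (fun _ _ => zero_le_one) ω
  have hpartial : ∀ m, ENNReal.ofReal (Real.exp (p * s m)) ≤ 1 + ∑ n ∈ Finset.range m,
      (A n).indicator (fun _ => ENNReal.ofReal (Real.exp (p * (n + 1 : ℕ)))) ω := by
    intro m
    induction m with
    | zero => simp [s]
    | succ m ih =>
      by_cases h : ω ∈ A m
      · rw [Finset.sum_range_succ, Set.indicator_of_mem h, ← add_assoc]
        refine le_add_left (ENNReal.ofReal_le_ofReal (Real.exp_le_exp.2 ?_))
        exact mul_le_mul_of_nonneg_left (hs_le (m + 1)) hp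
      · have : s (m + 1) = s m := by simp [s, Finset.sum_range_succ, h]
        rw [this, Finset.sum_range_succ, Set.indicator_of_notMem h, add_zero]
        exact ih
  have hlim : Tendsto (fun m => EReal.exp ((p : EReal) *
      ((∑ n ∈ Finset.range m, (A n).indicator (fun _ => (1 : ℝ≥0∞)) ω : ℝ≥0∞) : EReal))) atTop
      (𝓝 (EReal.exp ((p : EReal) * (deviationCount Y y ε ω : EReal)))) := by
    refine (ENNReal.continuous_exp.tendsto _).comp (EReal.Tendsto.const_mul ?_ ?_ ?_)
    · exact (continuous_coe_ennreal_ereal.tendsto _).comp (ENNReal.tendsto_nat_tsum _)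
    · exact Or.inl (EReal.coe_ne_bot p)
    · exact Or.inl (EReal.coe_ne_top p)
  refine le_of_tendsto' hlim fun m => ?_
  rw [hs_coe, ← EReal.coe_mul, EReal.exp_coe]
  exact (hpartial m).trans (add_le_add le_rfl (ENNReal.sum_le_tsum _))

lemma measurable_exp_mul_deviationCount {Y : ℕ → Ω → EuclideanSpace ℝ (Fin d)}
    (hY : ∀ n, Measurable (Y n)) (y : EuclideanSpace ℝ (Fin d)) (ε p : ℝ) :
    Measurable fun ω => EReal.exp ((p : EReal) * (deviationCount Y y ε ω : EReal)) := by
  have h : Measurable (deviationCount Y y ε) := by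
    refine Measurable.tsum fun n => measurable_const.indicator ?_
    exact measurableSet_le measurable_const ((hY (n + 1)).sub_const y).norm
  exact EReal.measurable_exp.comp (measurable_const.mul h.coe_ereal_ennreal)

/-- The events counted by `deviationCount` need only have geometrically decaying probabilities;
independence plays no role. -/
lemma lintegral_exp_mul_deviationCount_lt_top [IsProbabilityMeasure P]
    {Y : ℕ → Ω → EuclideanSpace ℝ (Fin d)} (hY : ∀ n, Measurable (Y n))
    (y : EuclideanSpace ℝ (Fin d)) (ε : ℝ) {p q : ℝ} (hp : 0 ≤ p) (hpq : p < q) {N : ℕ}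
    (h : ∀ n : ℕ, 0 < n →
      P {ω | ε ≤ ‖Y n ω - y‖} ≤ N * ENNReal.ofReal (Real.exp (-(q * n)))) :
    ∫⁻ ω, EReal.exp ((p : EReal) * (deviationCount Y y ε ω : EReal)) ∂P < ⊤ := by
  have hms : ∀ n, MeasurableSet {ω : Ω | ε ≤ ‖Y (n + 1) ω - y‖} := fun n =>
    measurableSet_le measurable_const ((hY (n + 1)).sub_const y).norm
  have hsum : Summable fun n : ℕ => (N : ℝ) * Real.exp ((n + 1 : ℕ) * (p - q)) :=
    (((Real.summable_exp_nat_mul_iff).2 (sub_neg.2 hpq)).comp_injective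
      (add_left_injective 1)).mul_left _
  calc ∫⁻ ω, EReal.exp ((p : EReal) * (deviationCount Y y ε ω : EReal)) ∂P
      ≤ ∫⁻ ω, (1 + ∑' n : ℕ, {ω' : Ω | ε ≤ ‖Y (n + 1) ω' - y‖}.indicator
        (fun _ => ENNReal.ofReal (Real.exp (p * (n + 1 : ℕ)))) ω) ∂P :=
        lintegral_mono fun ω => exp_mul_deviationCount_le Y y ε hp ω
    _ = 1 + ∑' n : ℕ, ENNReal.ofReal (Real.exp (p * (n + 1 : ℕ))) *
          P {ω | ε ≤ ‖Y (n + 1) ω - y‖} := by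
        rw [lintegral_add_left measurable_const, lintegral_tsum
          fun n => (measurable_const.indicator (hms n)).aemeasurable]
        simp [lintegral_indicator_const (hms _)]
    _ ≤ 1 + ∑' n : ℕ, ENNReal.ofReal ((N : ℝ) * Real.exp ((n + 1 : ℕ) * (p - q))) := by
        gcongr with n
        calc _ ≤ ENNReal.ofReal (Real.exp (p * (n + 1 : ℕ))) *
              (N * ENNReal.ofReal (Real.exp (-(q * (n + 1 : ℕ))))) := by
                gcongr
                exact h (n + 1) n.succ_pos
          _ = _ := by
                rw [mul_left_comm, ← ENNReal.ofReal_mul (Real.exp_pos _).le, ← Real.exp_add,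
                  ENNReal.ofReal_mul N.cast_nonneg, ENNReal.ofReal_natCast]
                congr 3
                ring
    _ < ⊤ := ENNReal.add_lt_top.2 ⟨ENNReal.one_lt_top, hsum.tsum_ofReal_lt_top⟩

lemma measure_le_deviationCount_le {Y : ℕ → Ω → EuclideanSpace ℝ (Fin d)}
    (hY : ∀ n, Measurable (Y n)) (y : EuclideanSpace ℝ (Fin d)) (ε : ℝ) {p : ℝ} (hp : 0 ≤ p)
    (k : ℕ) :
    P {ω | (k : ℝ≥0∞) ≤ deviationCount Y y ε ω} ≤
      (∫⁻ ω, EReal.exp ((p : EReal) * (deviationCount Y y ε ω : EReal)) ∂P) *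
        ENNReal.ofReal (Real.exp (-(p * k))) := by
  have hpos : 0 < Real.exp (p * k) := Real.exp_pos _
  rw [Real.exp_neg, ENNReal.ofReal_inv_of_pos hpos, ← div_eq_mul_inv]
  refine (measure_mono fun ω hω => ?_).trans (meas_ge_le_lintegral_div
    (measurable_exp_mul_deviationCount hY y ε p).aemeasurable
    (by simpa using hpos) ENNReal.ofReal_ne_top)
  have hω : (k : ℝ≥0∞) ≤ deviationCount Y y ε ω := hω
  have h₁ : ((k : ℝ) : EReal) ≤ (deviationCount Y y ε ω : EReal) := by
    rw [← ENNReal.ofReal_natCast] at hω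
    have := EReal.coe_ennreal_le_coe_ennreal_iff.2 hω
    rwa [EReal.coe_ennreal_ofReal, max_eq_left k.cast_nonneg] at this
  rw [Set.mem_ofPred_eq, ← EReal.exp_coe, EReal.exp_le_exp_iff, EReal.coe_mul]
  exact mul_le_mul_of_nonneg_left h₁ (by exact_mod_cast hp)

/-! ### The constant -/

lemma ofReal_le_boundConst (C : ℝ) (I : EReal) (p : ℝ) :
    ENNReal.ofReal C ≤ boundConst C I p := by
  have h : ∀ x : ℝ≥0∞, 1 ≤ (1 - x)⁻¹ := fun x => ENNReal.one_le_inv.2 tsub_le_self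
  exact (le_mul_of_one_le_right' (h _)).trans (le_mul_of_one_le_right' (h _))

lemma boundConst_lt_top (C : ℝ) {I : EReal} {p : ℝ} (hp : 0 < p) (hI : (p : EReal) < I) :
    boundConst C I p < ⊤ := by
  have h : ∀ J : EReal, 0 < J → (1 - EReal.exp (-J))⁻¹ < ⊤ := fun J hJ => by
    rw [ENNReal.inv_lt_top, tsub_pos_iff_lt, EReal.exp_lt_one_iff]
    simpa using hJ
  have hp' : (0 : EReal) < p := by exact_mod_cast hp
  refine ENNReal.mul_lt_top (ENNReal.mul_lt_top ENNReal.ofReal_lt_top (h _ (hp'.trans hI))) (h _ ?_)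
  exact EReal.sub_pos.2 hI

end MDF

theorem theorem3 {Ω : Type*} [MeasurableSpace Ω] (P : Measure Ω) [IsProbabilityMeasure P]
    {d : ℕ} (X : ℕ → Ω → EuclideanSpace ℝ (Fin d))
    (hmeas : ∀ i, Measurable (X i))
    (hindep : iIndepFun X P)
    (hident : ∀ i, IdentDistrib (X i) (X 0) P P)
    (hfin : ∀ l : EuclideanSpace ℝ (Fin d), MDF.logMGF P (X 0) l < ⊤) :
    Integrable (X 0) P ∧
    (∀ᵐ ω ∂P, Tendsto (fun n : ℕ => MDF.sampleMean X n ω) atTop (𝓝 (∫ ω', X 0 ω' ∂P))) ∧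
    ∀ (ε p : ℝ), 0 < ε → 0 < p →
      (p : EReal) < MDF.deviationRate P (X 0) (∫ ω', X 0 ω' ∂P) ε →
      ∃ C : ℝ, 0 < C ∧
        MDF.boundConst C (MDF.deviationRate P (X 0) (∫ ω', X 0 ω' ∂P) ε) p < ⊤ ∧
        (∫⁻ ω, EReal.exp ((p : EReal) *
            (MDF.deviationCount (MDF.sampleMean X) (∫ ω', X 0 ω' ∂P) ε ω : EReal)) ∂P)
          ≤ MDF.boundConst C (MDF.deviationRate P (X 0) (∫ ω', X 0 ω' ∂P) ε) p ∧
        ∀ k : ℕ,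
          P {ω | (k : ℝ≥0∞) ≤ MDF.deviationCount (MDF.sampleMean X) (∫ ω', X 0 ω' ∂P) ε ω}
            ≤ MDF.boundConst C (MDF.deviationRate P (X 0) (∫ ω', X 0 ω' ∂P) ε) p *
              ENNReal.ofReal (Real.exp (-(p * k))) := by
  have hint : Integrable (X 0) P := MDF.integrable_of_logMGF_lt_top (hmeas 0) hfin
  refine ⟨hint, strong_law_ae X hint (fun i j hij => hindep.indepFun hij) hident, ?_⟩
  intro ε p _ hp hpI
  set y := ∫ ω', X 0 ω' ∂P
  have hmean := MDF.measurable_sampleMean hmeas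
  obtain ⟨q, hpq, hqI⟩ := EReal.lt_iff_exists_real_btwn.1 hpI
  obtain ⟨N, hN⟩ := MDF.exists_measure_le_exp hmeas hindep hident hfin y hqI
  have htop := MDF.lintegral_exp_mul_deviationCount_lt_top hmean y ε hp.le
    (by exact_mod_cast hpq) hN
  set M := ∫⁻ ω, EReal.exp ((p : EReal) *
    (MDF.deviationCount (MDF.sampleMean X) y ε ω : EReal)) ∂P
  have hbound : M ≤ MDF.boundConst (M.toReal + 1) (MDF.deviationRate P (X 0) y ε) p := by
    refine le_trans ?_ (MDF.ofReal_le_boundConst _ _ _)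
    rw [← ENNReal.ofReal_toReal htop.ne]
    exact ENNReal.ofReal_le_ofReal (by simp)
  refine ⟨M.toReal + 1, by positivity, MDF.boundConst_lt_top _ hp hpI, hbound, fun k => ?_⟩
  exact (MDF.measure_le_deviationCount_le hmean y ε hp.le k).trans (mul_le_mul_left hbound _)
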